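/- Let $p$ be a prime number, and for a finite field $k$ of characteristic $p$ with algebraic closure $\bar k$, and a set $\Sigma$ of prime numbers, let $k_\Sigma \subseteq \bar k$ be the field generated over $k$ by the $\ell^j$-th roots of unity for all $\ell \in \Sigma\setminus\{p\}$ and $j \ge 0$. Call $\Sigma$ *$k$-small* if $k_\Sigma \ne \bar k$, and *$k$-large* if the set of all prime numbers not in $\Sigma$ is $k$-small. Say that $\Sigma$ has natural density $d$ if $\#\{\ell\in\Sigma : \ell\le n\}/\#\{\ell \text{ prime} : \ell \le n\} \to d$ as $n\to\infty$. Then: 1. There is a set of prime numbers of natural density $0$ that is not $\mathbb F_p$-small. 2. There is a set of prime numbers of natural density $1$ that is not $\mathbb F_p$-large. 3. For every finite field $k$ of characteristic $p$ there is a set of prime numbers that is neither $k$-large nor $k$-small. -/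

import Mathlib

/-- The field `k_Σ = k(ζ_{ℓ^j} | ℓ ∈ Σ, ℓ ≠ char k, j ≥ 0)`, inside an algebraic closure of `k`. -/
noncomputable def cyclotomicSubfield (k : Type*) [Field k] (S : Set Nat.Primes) :
    IntermediateField k (AlgebraicClosure k) :=
  IntermediateField.adjoin k
    {z | ∃ l ∈ S, (l : ℕ) ≠ ringChar k ∧ ∃ j : ℕ, IsPrimitiveRoot z ((l : ℕ) ^ j)}

/-- A set of primes `Σ` is `k`-small if `k_Σ` is not the whole algebraic closure of `k`. -/
def IsSmallFor (k : Type*) [Field k] (S : Set Nat.Primes) : Prop :=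
  cyclotomicSubfield k S ≠ ⊤

/-- A set of primes is `k`-large if its complement in the set of all primes is `k`-small. -/
def IsLargeFor (k : Type*) [Field k] (S : Set Nat.Primes) : Prop :=
  IsSmallFor k Sᶜ

/-- The set of primes `S` has natural density `d` (relative to the set of all primes):
`#{l ∈ S | l ≤ n} / π(n) → d` as `n → ∞`. -/
def HasNaturalDensity (S : Set Nat.Primes) (d : ℝ) : Prop :=
  Filter.Tendsto
    (fun n : ℕ => (({l : Nat.Primes | l ∈ S ∧ (l : ℕ) ≤ n}.ncard : ℝ) / (Nat.primeCounting n : ℝ)))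
    Filter.atTop (nhds d)

open Filter Polynomial Topology

/-! Let `q` be the cardinality of `k`. The degree of `k(ζ_l)` over `k` is a multiple of the order of
`q` mod `l`, and finite extensions of `k` are nested by divisibility of degrees. So `S` is not small
once every `n` divides such an order for some `l ∈ S`. Prime divisors of cyclotomic values supply
arbitrarily large `l` for each `n`, so they can be chosen as sparsely as desired: this gives density
`0`, and complements give density `1`. With `i!` dividing the `i`-th order, any infinite subsequence
suffices; even and odd indices then give two disjoint non-small sets. -/

/-- If `n` is not a prime power, then for every `q ≥ 2` there is a prime modulo which the order of
`q` is a multiple of `n`. -/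
theorem exists_prime_dvd_orderOf_of_not_prime_pow {q n : ℕ} (hq : 2 ≤ q) (hn : 1 < n)
    (hpow : ∀ {r : ℕ}, r.Prime → ∀ k : ℕ, r ^ k ≠ n) :
    ∃ l : ℕ, l.Prime ∧ ¬ l ∣ q ∧ n ∣ orderOf (q : ZMod l) ∧ n < l := by
  -- The exponent `φ(n)` excludes prime divisors `l` of `n`: for those, `l - 1 ∣ φ(n)` forces `b =
  -- 1` mod `l`, while `Φ_n(1) = 1`.
  have htot : n.totient ≠ 0 := (Nat.totient_pos.2 (by omega)).ne'
  set b := q ^ n.totient with hb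
  have hb2 : 2 ≤ b := hq.trans (Nat.le_self_pow htot q)
  have hgt : 1 < (eval (b : ℤ) (cyclotomic n ℤ)).natAbs :=
    lt_of_le_of_lt (by omega) (sub_one_lt_natAbs_cyclotomic_eval hn (by omega : b ≠ 1))
  obtain ⟨l, hl, hldvd⟩ := Nat.exists_prime_and_dvd hgt.ne'
  have : Fact l.Prime := ⟨hl⟩
  have hroot : IsRoot (cyclotomic n (ZMod l)) (b : ZMod l) := by
    have h : ((eval (b : ℤ) (cyclotomic n ℤ) : ℤ) : ZMod l) = 0 :=
      (ZMod.intCast_zmod_eq_zero_iff_dvd _ _).2 (Int.natCast_dvd.2 hldvd)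
    have h' := eval_intCast_map (Int.castRingHom (ZMod l)) (cyclotomic n ℤ) b
    rw [map_cyclotomic] at h'
    simpa [IsRoot.def, h] using h'
  have hbl : (b : ZMod l) ≠ 0 := by
    intro h0
    rw [h0, IsRoot.def, ← coeff_zero_eq_eval_zero, cyclotomic_coeff_zero _ hn] at hroot
    exact one_ne_zero hroot
  have hqb : (b : ZMod l) = (q : ZMod l) ^ n.totient := by rw [hb, Nat.cast_pow]
  have hql : (q : ZMod l) ≠ 0 := by
    intro h0
    exact hbl (by rw [hqb, h0, zero_pow htot])
  have hln : ¬ l ∣ n := by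
    intro h
    have hb1 : (b : ZMod l) = 1 := by
      obtain ⟨c, hc⟩ := Nat.totient_dvd_of_dvd h
      rw [hqb, hc, Nat.totient_prime hl, pow_mul, ZMod.pow_card_sub_one_eq_one hql, one_pow]
    rw [hb1, IsRoot.def, eval_one_cyclotomic_not_prime_pow hpow] at hroot
    exact one_ne_zero hroot
  have : NeZero (n : ZMod l) := NeZero.of_not_dvd (ZMod l) hln
  have hord : n ∣ orderOf (q : ZMod l) := by
    rw [(isRoot_cyclotomic_iff.1 hroot).eq_orderOf, hqb]
    exact orderOf_pow_dvd _
  refine ⟨l, hl, mt (CharP.cast_eq_zero_iff (ZMod l) l q).2 hql, hord, ?_⟩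
  have := Nat.le_of_dvd (by have := hl.two_le; omega)
    (hord.trans (ZMod.orderOf_dvd_card_sub_one hql))
  have := hl.two_le
  omega

/-- For `q ≥ 2` and `n ≥ 1` there are arbitrarily large primes modulo which the order of `q` is a
multiple of `n`. -/
theorem exists_prime_gt_dvd_orderOf {q n : ℕ} (hq : 2 ≤ q) (hn : n ≠ 0) (N : ℕ) :
    ∃ l : ℕ, l.Prime ∧ ¬ l ∣ q ∧ n ∣ orderOf (q : ZMod l) ∧ N < l := by
  have hpos : 0 < n * (N + 1) := Nat.mul_pos (Nat.pos_of_ne_zero hn) N.succ_pos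
  obtain ⟨l, hl, hlq, hord, hlt⟩ :=
    -- The factor `6` prevents a prime power; the factor `N + 1` forces `l > N`.
    exists_prime_dvd_orderOf_of_not_prime_pow (n := 6 * (n * (N + 1))) hq (by omega) (by
      intro r hr k hk
      have h2 := (Nat.prime_dvd_prime_iff_eq Nat.prime_two hr).1 (Nat.prime_two.dvd_of_dvd_pow
        (hk ▸ Dvd.dvd.mul_right (by norm_num) _))
      have h3 := (Nat.prime_dvd_prime_iff_eq Nat.prime_three hr).1 (Nat.prime_three.dvd_of_dvd_pow
        (hk ▸ Dvd.dvd.mul_right (by norm_num) _))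
      omega)
  refine ⟨l, hl, hlq, (Dvd.intro_left 6 rfl |>.trans hord |> (Dvd.intro _ rfl).trans), ?_⟩
  have : N + 1 ≤ n * (N + 1) := Nat.le_mul_of_pos_left _ (Nat.pos_of_ne_zero hn)
  omega

/-- A sparse sequence of distinct primes `l i` modulo which the order of `q` is a
multiple of `i!`. -/
theorem exists_sparse_primes_dvd_orderOf {q : ℕ} (hq : 2 ≤ q) :
    ∃ l : ℕ → Nat.Primes, Function.Injective l ∧ ∀ i, ¬ (l i : ℕ) ∣ q ∧
      i.factorial ∣ orderOf (q : ZMod (l i)) ∧ i ^ 2 ≤ Nat.primeCounting (l i) := by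
  obtain ⟨φ, hφ, h⟩ := extraction_forall_of_frequently (P := fun i l : ℕ => l.Prime ∧
      ¬ l ∣ q ∧ i.factorial ∣ orderOf (q : ZMod l) ∧ i ^ 2 ≤ Nat.primeCounting l) (by
    intro i
    have hfreq : ∃ᶠ l : ℕ in atTop, l.Prime ∧ ¬ l ∣ q ∧ i.factorial ∣ orderOf (q : ZMod l) := by
      refine frequently_atTop.2 fun N => ?_
      obtain ⟨l, hl, hlq, hord, hlt⟩ := exists_prime_gt_dvd_orderOf hq i.factorial_ne_zero N
      exact ⟨l, hlt.le, hl, hlq, hord⟩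
    exact (hfreq.and_eventually (Nat.tendsto_primeCounting.eventually_ge_atTop (i ^ 2))).mono
      fun l hl => ⟨hl.1.1, hl.1.2.1, hl.1.2.2, hl.2⟩)
  exact ⟨fun i => ⟨φ i, (h i).1⟩, fun i j hij => hφ.injective (congrArg Subtype.val hij), fun i => (h i).2⟩

/-- An intermediate field of degree divisible by `n` contains the solutions of `x ^ (q ^ n) = x`,
where `q` is the cardinality of the base field. -/
theorem mem_of_pow_natCard_pow_eq_self {k L : Type*} [Field k] [Finite k] [Field L] [Algebra k L]
    (K : IntermediateField k L) [FiniteDimensional k K] {n : ℕ} (hn : n ∣ Module.finrank k K)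
    {x : L} (hx : x ^ (Nat.card k ^ n) = x) : x ∈ K := by
  classical
  have : Finite K := Module.finite_of_finite k
  have := Fintype.ofFinite K
  obtain ⟨c, hc⟩ := hn
  have hcard : Fintype.card K = (Nat.card k ^ n) ^ c := by
    rw [← Nat.card_eq_fintype_card, Module.natCard_eq_pow_finrank (K := k), hc, pow_mul]
  have hxK : x ^ Fintype.card K = x := by
    rw [hcard]
    clear hcard hc
    induction c with
    | zero => simp
    | succ c ih => rw [pow_succ, pow_mul, ih, hx]
  have hprod := FiniteField.X_pow_card_sub_X_ne_zero L (Fintype.one_lt_card (α := K))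
  -- The elements of `K` already exhaust the at most `|K|` roots in `L`.
  have hsub : Finset.univ.map ⟨(algebraMap K L), (algebraMap K L).injective⟩ =
      (X ^ Fintype.card K - X : L[X]).roots.toFinset := by
    refine Finset.eq_of_subset_of_card_le (fun y hy => ?_) ?_
    · obtain ⟨a, -, rfl⟩ := Finset.mem_map.1 hy
      rw [Multiset.mem_toFinset, mem_roots hprod]
      simpa [IsRoot.def, sub_eq_zero] using congrArg Subtype.val (FiniteField.pow_card a)
    · rw [Finset.card_map, Finset.card_univ]
      exact (Multiset.toFinset_card_le _).trans ((card_roots' _).trans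
        (FiniteField.X_pow_card_sub_X_natDegree_eq L Fintype.one_lt_card).le)
  have hmem : x ∈ (X ^ Fintype.card K - X : L[X]).roots.toFinset := by
    rw [Multiset.mem_toFinset, mem_roots hprod]
    simp [IsRoot.def, hxK]
  rw [← hsub] at hmem
  obtain ⟨a, -, rfl⟩ := Finset.mem_map.1 hmem
  exact a.2

/-- The order of `q` modulo `l` divides the degree of a finite extension of a field with `q`
elements that contains a primitive `l`-th root of unity. -/
theorem IsPrimitiveRoot.orderOf_natCard_dvd_finrank {k K : Type*} [Field k] [Finite k] [Field K]
    [Algebra k K] [FiniteDimensional k K] {l : ℕ} {z : K} (hz : IsPrimitiveRoot z l)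
    (hl : l ≠ 0) : orderOf (Nat.card k : ZMod l) ∣ Module.finrank k K := by
  have : Finite K := Module.finite_of_finite k
  have := Fintype.ofFinite K
  have hcard : Fintype.card K = Nat.card k ^ Module.finrank k K := by
    rw [← Nat.card_eq_fintype_card, Module.natCard_eq_pow_finrank (K := k)]
  have hdvd : l ∣ Fintype.card K - 1 :=
    hz.dvd_of_pow_eq_one _ (FiniteField.pow_card_sub_one_eq_one z (hz.ne_zero hl))
  rw [orderOf_dvd_iff_pow_eq_one, ← Nat.cast_pow, ← hcard]
  have h := (ZMod.natCast_eq_zero_iff (Fintype.card K - 1) l).2 hdvd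
  rwa [Nat.cast_sub Fintype.card_pos, Nat.cast_one, sub_eq_zero] at h

/-- A set of primes `S` is not small for a finite field `k` if every `n ≥ 1` divides the order of
the cardinality of `k` modulo some prime in `S` different from the characteristic. -/
theorem not_isSmallFor_of_dvd_orderOf {k : Type*} [Field k] [Finite k] {S : Set Nat.Primes}
    (h : ∀ n : ℕ, n ≠ 0 → ∃ l ∈ S, ¬ (l : ℕ) ∣ Nat.card k ∧
      n ∣ orderOf (Nat.card k : ZMod l)) : ¬ IsSmallFor k S := by
  -- Each `x` lies in `k(ζ_l)` for a single `l ∈ S`, chosen for the degree of `x`.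
  refine not_not.2 (eq_top_iff.2 fun x _ => ?_)
  have hxint : IsIntegral k x := Algebra.IsIntegral.isIntegral x
  have := IntermediateField.adjoin.finiteDimensional hxint
  have : Finite (IntermediateField.adjoin k {x}) := Module.finite_of_finite k
  have hx : x ^ (Nat.card k ^ Module.finrank k (IntermediateField.adjoin k {x})) = x := by
    have := Fintype.ofFinite (IntermediateField.adjoin k {x})
    have h1 := FiniteField.pow_card (IntermediateField.AdjoinSimple.gen k x)
    rw [← Nat.card_eq_fintype_card, Module.natCard_eq_pow_finrank (K := k)] at h1
    simpa using congrArg Subtype.val h1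
  obtain ⟨l, hlS, hlk, hord⟩ := h _
    (Module.finrank_pos (R := k) (M := IntermediateField.adjoin k {x})).ne'
  have hchar : (l : ℕ) ≠ ringChar k := by
    intro hl
    have h0 : ((Nat.card k : ℕ) : k) = 0 := by
      have := Fintype.ofFinite k
      rw [Nat.card_eq_fintype_card, FiniteField.cast_card_eq_zero]
    exact hlk (hl ▸ (ringChar.spec k _).1 h0)
  have hlne : ((l : ℕ) : AlgebraicClosure k) ≠ 0 := by
    intro h0
    have h0' : ((l : ℕ) : k) = 0 :=
      (algebraMap k (AlgebraicClosure k)).injective (by simpa using h0)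
    rcases (Nat.dvd_prime l.2).1 ((ringChar.spec k _).1 h0') with h1 | h1
    · exact CharP.ringChar_ne_one h1
    · exact hchar h1.symm
  have : NeZero ((l : ℕ) : AlgebraicClosure k) := ⟨hlne⟩
  obtain ⟨z, hz⟩ :=
    HasEnoughRootsOfUnity.exists_primitiveRoot (AlgebraicClosure k) (l : ℕ)
  have hzint : IsIntegral k z := Algebra.IsIntegral.isIntegral z
  have := IntermediateField.adjoin.finiteDimensional hzint
  have hgen : IsPrimitiveRoot (IntermediateField.AdjoinSimple.gen k z) l :=
    IsPrimitiveRoot.coe_submonoidClass_iff.1 (by simpa using hz)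
  have hxz : x ∈ IntermediateField.adjoin k {z} := mem_of_pow_natCard_pow_eq_self _
    (hord.trans (hgen.orderOf_natCard_dvd_finrank l.2.ne_zero)) hx
  refine IntermediateField.adjoin.mono k _ _ ?_ hxz
  rintro _ rfl
  exact ⟨l, hlS, hchar, 1, by simpa using hz⟩

/-- A set of primes whose `i`-th element exceeds at least `i ^ 2` primes has density zero. -/
theorem hasNaturalDensity_zero_of_sq_le {l : ℕ → Nat.Primes}
    (hl : ∀ i, i ^ 2 ≤ Nat.primeCounting (l i)) : HasNaturalDensity (Set.range l) 0 := by
  have hbound : ∀ n : ℕ, ({r : Nat.Primes | r ∈ Set.range l ∧ (r : ℕ) ≤ n}.ncard : ℝ) ≤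
      √(Nat.primeCounting n) + 1 := by
    intro n
    have hsub : {r : Nat.Primes | r ∈ Set.range l ∧ (r : ℕ) ≤ n} ⊆
        l '' (Finset.range (Nat.sqrt (Nat.primeCounting n) + 1) : Set ℕ) := by
      rintro _ ⟨⟨i, rfl⟩, hi⟩
      refine ⟨i, ?_, rfl⟩
      rw [Finset.mem_coe, Finset.mem_range, Nat.lt_succ_iff, Nat.le_sqrt']
      exact (hl i).trans (Nat.monotone_primeCounting hi)
    have hcard := (Set.ncard_le_ncard hsub ((Finset.finite_toSet _).image l)).trans
      (Set.ncard_image_le (Finset.finite_toSet _))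
    rw [Set.ncard_coe_finset, Finset.card_range] at hcard
    calc _ ≤ ((Nat.sqrt (Nat.primeCounting n) + 1 : ℕ) : ℝ) := by exact_mod_cast hcard
      _ ≤ _ := by push_cast; gcongr; exact Real.nat_sqrt_le_real_sqrt
  have hsqrt : Tendsto (fun n : ℕ => √(Nat.primeCounting n : ℝ)) atTop atTop :=
    Real.tendsto_sqrt_atTop.comp (tendsto_natCast_atTop_atTop.comp Nat.tendsto_primeCounting)
  have hlim : Tendsto (fun n : ℕ => (√(Nat.primeCounting n : ℝ))⁻¹ + (√(Nat.primeCounting n : ℝ))⁻¹ ^ 2)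
      atTop (𝓝 0) := by
    simpa using hsqrt.inv_tendsto_atTop.add (hsqrt.inv_tendsto_atTop.pow 2)
  refine squeeze_zero' (Eventually.of_forall fun n => by positivity) ?_ hlim
  filter_upwards [hsqrt.eventually_gt_atTop 0] with n hn
  refine (div_le_div_of_nonneg_right (hbound n) (Nat.cast_nonneg _)).trans (le_of_eq ?_)
  nth_rewrite 2 [← Real.sq_sqrt (Nat.cast_nonneg (Nat.primeCounting n))]
  field_simp

/-- The number of primes up to `n`, as the cardinality of a set of elements of `Nat.Primes`. -/
theorem ncard_primes_le (n : ℕ) :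
    {r : Nat.Primes | (r : ℕ) ≤ n}.ncard = Nat.primeCounting n := by
  rw [Nat.primeCounting, Nat.primeCounting', Nat.count_eq_card_filter_range,
    ← Set.ncard_coe_finset, ← Set.ncard_image_of_injective {r : Nat.Primes | (r : ℕ) ≤ n} Nat.Primes.coe_nat_injective]
  congr 1
  ext m
  simp only [Set.mem_ofPred_eq, Finset.coe_filter, Finset.mem_range,
    Nat.lt_succ_iff]
  exact ⟨fun ⟨r, hr, h⟩ => h ▸ ⟨hr, r.2⟩, fun ⟨h, hm⟩ => ⟨⟨m, hm⟩, h, rfl⟩⟩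

/-- The complement of a set of primes of density `d` has density `1 - d`. -/
theorem HasNaturalDensity.compl {S : Set Nat.Primes} {d : ℝ} (h : HasNaturalDensity S d) :
    HasNaturalDensity Sᶜ (1 - d) := by
  refine (h.const_sub 1).congr' ?_
  filter_upwards [Nat.tendsto_primeCounting.eventually_gt_atTop 0] with n hn
  have hfin : {r : Nat.Primes | (r : ℕ) ≤ n}.Finite :=
    Set.finite_of_ncard_pos (by rw [ncard_primes_le]; exact hn)
  have hcard := Set.ncard_inter_add_ncard_sdiff_eq_ncard {r : Nat.Primes | (r : ℕ) ≤ n} S hfin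
  rw [ncard_primes_le] at hcard
  have h1 : {r : Nat.Primes | (r : ℕ) ≤ n} ∩ S = {r | r ∈ S ∧ (r : ℕ) ≤ n} := by
    ext; exact and_comm
  have h2 : {r : Nat.Primes | (r : ℕ) ≤ n} \ S = {r | r ∈ Sᶜ ∧ (r : ℕ) ≤ n} := by
    ext; exact and_comm
  rw [h1, h2] at hcard
  have hn' : (Nat.primeCounting n : ℝ) ≠ 0 := by exact_mod_cast hn.ne'
  rw [eq_div_iff hn', sub_mul, div_mul_cancel₀ _ hn', ← hcard]
  push_cast
  ring

theorem mainTheorem8 (p : ℕ) [Fact p.Prime] :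
    (∃ S : Set Nat.Primes, HasNaturalDensity S 0 ∧ ¬ IsSmallFor (ZMod p) S) ∧
    (∃ S : Set Nat.Primes, HasNaturalDensity S 1 ∧ ¬ IsLargeFor (ZMod p) S) ∧
    (∀ (k : Type*) [Field k] [Finite k] [CharP k p],
      ∃ S : Set Nat.Primes, ¬ IsLargeFor k S ∧ ¬ IsSmallFor k S) := by
  have hzero : ∃ S : Set Nat.Primes, HasNaturalDensity S 0 ∧ ¬ IsSmallFor (ZMod p) S := by
    obtain ⟨l, -, h⟩ := exists_sparse_primes_dvd_orderOf (Finite.one_lt_card (α := ZMod p))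
    exact ⟨Set.range l, hasNaturalDensity_zero_of_sq_le fun i => (h i).2.2,
      not_isSmallFor_of_dvd_orderOf fun n hn => ⟨l n, ⟨n, rfl⟩, (h n).1,
        (Nat.dvd_factorial (Nat.pos_of_ne_zero hn) le_rfl).trans (h n).2.1⟩⟩
  refine ⟨hzero, ?_, fun k _ _ _ => ?_⟩
  · obtain ⟨S, hS, hsmall⟩ := hzero
    exact ⟨Sᶜ, by simpa using hS.compl, by rwa [IsLargeFor, compl_compl]⟩
  · obtain ⟨l, hl, h⟩ := exists_sparse_primes_dvd_orderOf (Finite.one_lt_card (α := k))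
    -- The complement contains the odd-indexed primes, by injectivity of `l`.
    refine ⟨Set.range fun i => l (2 * i),
      not_isSmallFor_of_dvd_orderOf fun n hn => ⟨l (2 * n + 1), ?_, (h _).1,
        (Nat.dvd_factorial (Nat.pos_of_ne_zero hn) (by omega)).trans (h _).2.1⟩,
      not_isSmallFor_of_dvd_orderOf fun n hn => ⟨l (2 * n), ⟨n, rfl⟩, (h _).1,
        (Nat.dvd_factorial (Nat.pos_of_ne_zero hn) (by omega)).trans (h _).2.1⟩⟩
    rintro ⟨i, hi⟩
    have := hl hi
    omega
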